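/- The degree of a rational function (over $\mathbb{Q}$, in several variables) is the maximum of the total degrees of its numerator and its denominator when it is written in lowest terms; it is well-defined at a point if that denominator does not vanish there. Let $k\ge 1$ and $D\ge 1$ be integers, let $P_1,\dots,P_k\in\mathbb{Q}(x_1,\dots,x_k)$ be rational functions of degree at most $D$, and let $F^{(1)},\dots,F^{(k)}$ be sequences of elements of the field $\mathbb{Q}(x_1,\dots,x_k)$ such that, for all $i\in\{1,\dots,k\}$ and $n\in\mathbb{N}=\{0,1,2,\dots\}$, $$F^{(i)}_0=x_i,\qquad F^{(i)}_{n+1}=P_i\bigl(F^{(1)}_n,\dots,F^{(k)}_n\bigr),$$ where all the right-hand sides are well-defined. Then there exist an integer $m\ge 0$ with $$m\le k+k^3\log(kD)$$ ($\log$ is the natural logarithm) and a rational function $R\in\mathbb{Q}(y_0,\dots,y_m)$ such that, for all $n\in\mathbb{N}$, $R$ is well-defined at $(F^{(1)}_n,F^{(1)}_{n+1},\dots,F^{(1)}_{n+m})$ and $$F^{(1)}_{n+m+1}=R\bigl(F^{(1)}_n,F^{(1)}_{n+1},\dots,F^{(1)}_{n+m}\bigr).$$ -/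

import Mathlib

namespace Ratrec

/-- The field `K(x_i : i ∈ σ)` of rational functions over `K` in the variables indexed by `σ`. -/
abbrev RatFn (σ K : Type*) [Field K] : Type _ := FractionRing (MvPolynomial σ K)

section

variable {σ K : Type*} [Field K]

/-- The variable `x_i`, as a rational function. -/
noncomputable def RatFn.X (i : σ) : RatFn σ K :=
  algebraMap (MvPolynomial σ K) (RatFn σ K) (MvPolynomial.X i)

/-- The numerator of a rational function written in lowest terms (unique up to a nonzero constant
which is shared with the denominator). -/
noncomputable def RatFn.num (f : RatFn σ K) : MvPolynomial σ K :=
  IsFractionRing.num (MvPolynomial σ K) f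

/-- The denominator of a rational function written in lowest terms. -/
noncomputable def RatFn.den (f : RatFn σ K) : MvPolynomial σ K :=
  (IsFractionRing.den (MvPolynomial σ K) f : MvPolynomial σ K)

/-- The degree of a rational function: the maximum of the total degrees of its numerator and of its
denominator. -/
noncomputable def RatFn.degree (f : RatFn σ K) : ℕ :=
  max f.num.totalDegree f.den.totalDegree

variable {E : Type*} [Field E] [Algebra K E]

/-- The rational function `f` is well-defined at the point `a` with coordinates in an extension
field `E` of `K`: its denominator does not vanish there. -/
def RatFn.DefinedAt (f : RatFn σ K) (a : σ → E) : Prop :=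
  MvPolynomial.aeval a f.den ≠ 0

/-- The value of the rational function `f` at the point `a` (meaningful if `f.DefinedAt a`). -/
noncomputable def RatFn.eval (f : RatFn σ K) (a : σ → E) : E :=
  MvPolynomial.aeval a f.num / MvPolynomial.aeval a f.den

/-- The sequences `u 0, …, u (k - 1)` over the field `E` satisfy the rational recursive system of
dimension `k` and degree (at most) `D` given by the rational functions `P 0, …, P (k - 1)` with
coefficients in `K`:  `u^{(i)}_{n+1} = P_i(u^{(1)}_n, …, u^{(k)}_n)` for all `i` and `n`, all the
right-hand sides being well-defined. -/
structure IsSystem {k : ℕ} (D : ℕ) (P : Fin k → RatFn (Fin k) K) (u : Fin k → ℕ → E) : Prop where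
  degree_le : ∀ i, (P i).degree ≤ D
  defined : ∀ n i, (P i).DefinedAt (fun j => u j n)
  step : ∀ n i, u i (n + 1) = (P i).eval (fun j => u j n)

/-- The sequence `u` over `E` satisfies the simple recursion
`u_{n+m+1} = R(u_n, u_{n+1}, …, u_{n+m})` for all `n`, all the right-hand sides being
well-defined. -/
def SatisfiesSimpleRecursion {m : ℕ} (R : RatFn (Fin (m + 1)) K) (u : ℕ → E) : Prop :=
  ∀ n, R.DefinedAt (fun j : Fin (m + 1) => u (n + j)) ∧
    u (n + m + 1) = R.eval (fun j : Fin (m + 1) => u (n + j))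

end

end Ratrec

namespace Ratrec

/-! ### Shift algebras of sequences and the drop of transcendence degree. -/

section Sequences

variable {K E : Type*} [Field K] [Field E] [Algebra K E]

/-! Let `G = rationalAlong K F`. Since `F` starts at the variables, an element of `G` is determined
by its value at `0`, so `z n ↦ z (n + 1)` is a well-defined surjection from the values of `G` at `n`
to those at `n + 1`. These are domains, so each non-injective shift lowers the transcendence degree
(`hasIndep_succ`). Hence there is an `n₀` with `n₀` plus the remaining degree at most `k`, from
which on all shifts are injective, and algebraic relations at `n₀` hold exactly when they hold at
any later index.

Write `f = F i₀`. The longest algebraically independent block `f n₀, …, f (n₀ + s - 1)` has `s + n₀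
≤ k`, and every later value is algebraic over it. Adjoin the later values one by one: each proper
field extension at least doubles the dimension. A Hilbert-function count
(`card_le_of_linearIndependent_of_isAlgebraic`) bounds that dimension through the degrees of the
block, which are at most `(k * D) ^ (k - 1)`. So after at most `k ^ 3 * log (k * D)` steps, a value
of `f` is a rational function of the preceding ones, and this relation transfers to all `n ≥ n₀`. -/

theorem aeval_pi_apply {ι : Type*} (z : ι → ℕ → E) (p : MvPolynomial ι K) (n : ℕ) :
    MvPolynomial.aeval z p n = MvPolynomial.aeval (fun i => z i n) p := by
  have := MvPolynomial.comp_aeval_apply (Pi.evalAlgHom K (fun _ : ℕ => E) n) (f := z) p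
  simpa using this

theorem aeval_seq_mem {ι : Type*} {G : Subalgebra K (ℕ → E)} {z : ι → ℕ → E}
    (hz : ∀ i, z i ∈ G) (p : MvPolynomial ι K) :
    (fun n => MvPolynomial.aeval (fun i => z i n) p) ∈ G := by
  have h : MvPolynomial.aeval z p ∈ G := by
    have h1 : MvPolynomial.aeval z p ∈ Algebra.adjoin K (Set.range z) := by
      rw [Algebra.adjoin_range_eq_range_aeval]
      exact ⟨p, rfl⟩
    refine Algebra.adjoin_le ?_ h1
    rintro _ ⟨i, rfl⟩
    exact hz i
  convert h using 1
  funext n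
  exact (aeval_pi_apply z p n).symm

/-- The algebra of sequences `n ↦ r (u n)` for rational functions `r` which have a denominator that
vanishes at no point `u n`. -/
noncomputable def rationalAlong (K : Type*) [Field K] [Algebra K E] {σ : Type*} (u : σ → ℕ → E) :
    Subalgebra K (ℕ → E) where
  carrier := {z | ∃ a b : MvPolynomial σ K, ∀ n, MvPolynomial.aeval (fun i => u i n) b ≠ 0 ∧
    z n = MvPolynomial.aeval (fun i => u i n) a / MvPolynomial.aeval (fun i => u i n) b}
  mul_mem' := by
    rintro z w ⟨a, b, h⟩ ⟨c, d, h'⟩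
    refine ⟨a * c, b * d, fun n => ⟨?_, ?_⟩⟩
    · rw [map_mul]
      exact mul_ne_zero (h n).1 (h' n).1
    · rw [Pi.mul_apply, (h n).2, (h' n).2, map_mul, map_mul, div_mul_div_comm]
  add_mem' := by
    rintro z w ⟨a, b, h⟩ ⟨c, d, h'⟩
    refine ⟨a * d + b * c, b * d, fun n => ⟨?_, ?_⟩⟩
    · rw [map_mul]
      exact mul_ne_zero (h n).1 (h' n).1
    · rw [Pi.add_apply, (h n).2, (h' n).2, map_add, map_mul, map_mul, map_mul,
        div_add_div _ _ (h n).1 (h' n).1]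
  algebraMap_mem' r := ⟨MvPolynomial.C r, 1, fun n => by simp⟩

variable {σ : Type*} {u : σ → ℕ → E}

theorem coord_mem_rationalAlong (i : σ) : u i ∈ rationalAlong K u :=
  ⟨MvPolynomial.X i, 1, fun n => by simp⟩

theorem div_mem_rationalAlong {z w : ℕ → E} (hz : z ∈ rationalAlong K u)
    (hw : w ∈ rationalAlong K u) (h0 : ∀ n, w n ≠ 0) :
    (fun n => z n / w n) ∈ rationalAlong K u := by
  obtain ⟨a, b, h⟩ := hz
  obtain ⟨c, d, h'⟩ := hw
  refine ⟨a * d, b * c, fun n => ?_⟩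
  have hc : MvPolynomial.aeval (fun i => u i n) c ≠ 0 := by
    intro hc
    apply h0 n
    rw [(h' n).2, hc, zero_div]
  refine ⟨?_, ?_⟩
  · rw [map_mul]
    exact mul_ne_zero (h n).1 hc
  · simp only [(h n).2, (h' n).2, map_mul, div_div_div_eq]

theorem shift_mem_rationalAlong (hu : ∀ i, (fun n => u i (n + 1)) ∈ rationalAlong K u)
    {z : ℕ → E} (hz : z ∈ rationalAlong K u) : (fun n => z (n + 1)) ∈ rationalAlong K u := by
  obtain ⟨a, b, h⟩ := hz
  have := div_mem_rationalAlong (aeval_seq_mem hu a) (aeval_seq_mem hu b) fun n => (h (n + 1)).1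
  convert this using 2 with n
  exact (h (n + 1)).2

/-- At an algebraically independent point the numerator must be the zero polynomial. -/
theorem eq_zero_of_mem_rationalAlong {n₀ : ℕ} (hu : AlgebraicIndependent K fun i => u i n₀)
    {z : ℕ → E} (hz : z ∈ rationalAlong K u) (h0 : z n₀ = 0) (n : ℕ) : z n = 0 := by
  obtain ⟨a, b, h⟩ := hz
  have ha : a = 0 := by
    have h1 := (h n₀).2
    rw [h0, eq_comm, div_eq_zero_iff, or_iff_left (h n₀).1] at h1
    exact hu.eq_zero_of_aeval_eq_zero a h1
  rw [(h n).2, ha, map_zero, zero_div]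

/-- An algebra of sequences which is closed under shifts and whose elements are determined by their
value at `0`. -/
structure IsShiftAlgebra (G : Subalgebra K (ℕ → E)) : Prop where
  shift_mem : ∀ z ∈ G, (fun n => z (n + 1)) ∈ G
  eq_zero : ∀ z ∈ G, z 0 = 0 → z 1 = 0

namespace IsShiftAlgebra

variable {G : Subalgebra K (ℕ → E)}

theorem shift_add_mem (hG : IsShiftAlgebra G) {z : ℕ → E} (hz : z ∈ G) (j : ℕ) :
    (fun n => z (n + j)) ∈ G := by
  induction j with
  | zero => exact hz
  | succ j ih =>
    convert hG.shift_mem _ ih using 2 with n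
    congr 1
    omega

theorem apply_succ_eq_zero (hG : IsShiftAlgebra G) {z : ℕ → E} (hz : z ∈ G) {n : ℕ}
    (h : z n = 0) : z (n + 1) = 0 := by
  have := hG.eq_zero _ (hG.shift_add_mem hz n) (by simpa using h)
  rwa [add_comm n]

theorem apply_eq_zero_of_le (hG : IsShiftAlgebra G) {z : ℕ → E} (hz : z ∈ G) {n m : ℕ}
    (hnm : n ≤ m) (h : z n = 0) : z m = 0 := by
  induction m, hnm using Nat.le_induction with
  | base => exact h
  | succ m _ ih => exact hG.apply_succ_eq_zero hz ih

/-- From `n₀` on, the shift is injective on values. -/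
def StableFrom (G : Subalgebra K (ℕ → E)) (n₀ : ℕ) : Prop :=
  ∀ z ∈ G, z (n₀ + 1) = 0 → z n₀ = 0

theorem apply_eq_zero_iff (hG : IsShiftAlgebra G) {n₀ : ℕ} (hs : StableFrom G n₀) {z : ℕ → E}
    (hz : z ∈ G) {n : ℕ} (hn : n₀ ≤ n) : z n = 0 ↔ z n₀ = 0 := by
  refine ⟨?_, hG.apply_eq_zero_of_le hz hn⟩
  -- Stability at `n` applied to the shifted sequence is stability at `n + 1`.
  have key : ∀ n, n₀ ≤ n → StableFrom G n := by
    intro n hn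
    induction n, hn using Nat.le_induction with
    | base => exact hs
    | succ n _ ih => exact fun z hz h => ih _ (hG.shift_mem z hz) h
  induction n, hn using Nat.le_induction with
  | base => exact id
  | succ n hn ih => exact fun h => ih (key n hn z hz h)

/-- There are `r` sequences of `G` with values at `n` algebraically independent. -/
def HasIndep (G : Subalgebra K (ℕ → E)) (n r : ℕ) : Prop :=
  ∃ z : Fin r → ℕ → E, (∀ i, z i ∈ G) ∧ AlgebraicIndependent K fun i => z i n

theorem algebraicIndependent_of_succ (hG : IsShiftAlgebra G) {ι : Type*} {z : ι → ℕ → E}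
    (hz : ∀ i, z i ∈ G) {n : ℕ} (h : AlgebraicIndependent K fun i => z i (n + 1)) :
    AlgebraicIndependent K fun i => z i n := by
  rw [algebraicIndependent_iff] at h ⊢
  exact fun p hp => h p (hG.apply_succ_eq_zero (aeval_seq_mem hz p) hp)

theorem algebraicIndependent_iff (hG : IsShiftAlgebra G) {n₀ : ℕ} (hs : StableFrom G n₀)
    {ι : Type*} {z : ι → ℕ → E} (hz : ∀ i, z i ∈ G) {n : ℕ} (hn : n₀ ≤ n) :
    (AlgebraicIndependent K fun i => z i n) ↔ AlgebraicIndependent K fun i => z i n₀ := by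
  rw [_root_.algebraicIndependent_iff, _root_.algebraicIndependent_iff]
  exact forall_congr' fun p => by rw [hG.apply_eq_zero_iff hs (aeval_seq_mem hz p) hn]

/-- A nonzero value `w n` killed by the shift is transcendental over any family that stays
independent after the shift. -/
theorem hasIndep_succ (hG : IsShiftAlgebra G) {n r : ℕ} (hn : ¬ StableFrom G n)
    (h : HasIndep G (n + 1) r) : HasIndep G n (r + 1) := by
  obtain ⟨z, hz, hind⟩ := h
  simp only [StableFrom, not_forall] at hn
  obtain ⟨w, hw, hw1, hw0⟩ := hn
  have hind' := hG.algebraicIndependent_of_succ hz hind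
  have htr : Transcendental (Algebra.adjoin K (Set.range fun i => z i n)) (w n) := by
    intro halg
    -- Choose a relation with nonzero constant coefficient. After the shift `w` vanishes, and only
    -- this coefficient survives, contradicting the independence of the `z i (n + 1)`.
    obtain ⟨q, hq0, hq⟩ := halg.exists_nonzero_coeff_and_aeval_eq_zero
      (mem_nonZeroDivisors_of_ne_zero hw0)
    have hlift : ∀ j, ∃ p : MvPolynomial (Fin r) K,
        MvPolynomial.aeval (fun i => z i n) p = (q.coeff j : E) := by
      intro j
      exact (Algebra.adjoin_range_eq_range_aeval K _).le (q.coeff j).2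
    choose p hp using hlift
    have hmem : (∑ j ∈ Finset.range (q.natDegree + 1),
        (fun m => MvPolynomial.aeval (fun i => z i m) (p j)) * w ^ j) ∈ G :=
      sum_mem fun j _ => mul_mem (aeval_seq_mem hz (p j)) (pow_mem hw j)
    have h0 := hG.apply_succ_eq_zero (n := n) hmem (by
      rw [Polynomial.aeval_eq_sum_range] at hq
      rw [Finset.sum_apply, ← hq]
      refine Finset.sum_congr rfl fun j _ => ?_
      rw [Pi.mul_apply, hp j, Pi.pow_apply, Algebra.smul_def]
      rfl)
    rw [Finset.sum_apply, Finset.sum_range_succ', Finset.sum_eq_zero, zero_add, Pi.mul_apply,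
      pow_zero, Pi.one_apply, mul_one] at h0
    · have hp0 := hind.eq_zero_of_aeval_eq_zero _ h0
      apply hq0
      have := hp 0
      rw [hp0, map_zero] at this
      exact Subtype.ext this.symm
    · intro j _
      rw [Pi.mul_apply, Pi.pow_apply, hw1, zero_pow (Nat.succ_ne_zero j), mul_zero]
  have hopt := (AlgebraicIndependent.option_iff_transcendental hind' (w n)).2 htr
  refine ⟨fun i => (finSuccEquiv r i).elim w z, fun i => ?_, ?_⟩
  · change (finSuccEquiv r i).elim w z ∈ G
    cases finSuccEquiv r i with
    | none => exact hw
    | some j => exact hz j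
  · convert hopt.comp _ (finSuccEquiv r).injective using 2 with i
    change (finSuccEquiv r i).elim w z n = (finSuccEquiv r i).elim (w n) fun i => z i n
    cases finSuccEquiv r i <;> rfl

theorem exists_stableFrom (hG : IsShiftAlgebra G) {k : ℕ} (hk : ∀ r, HasIndep G 0 r → r ≤ k) :
    ∃ n₀, StableFrom G n₀ ∧ ∀ r, HasIndep G n₀ r → r + n₀ ≤ k := by
  classical
  have key : ∀ n, (∀ i < n, ¬ StableFrom G i) → ∀ r, HasIndep G n r → r + n ≤ k := by
    intro n
    induction n with
    | zero => exact fun _ r hr => hk r hr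
    | succ n ih =>
      intro h r hr
      have := ih (fun i hi => h i (by omega)) (r + 1) (hG.hasIndep_succ (h n (by omega)) hr)
      omega
  have hex : ∃ n, StableFrom G n := by
    by_contra! hcon
    have h0 : HasIndep G (k + 1) 0 :=
      ⟨Fin.elim0, fun i => i.elim0, algebraicIndependent_empty_type_iff.2
        (algebraMap K E).injective⟩
    have := key (k + 1) (fun i _ => hcon i) 0 h0
    omega
  exact ⟨Nat.find hex, Nat.find_spec hex, key _ fun i hi => Nat.find_min hex hi⟩

theorem exists_algebraicIndependent_initial (hG : IsShiftAlgebra G) {n₀ k : ℕ}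
    (hs : StableFrom G n₀) (hk : ∀ r, HasIndep G n₀ r → r + n₀ ≤ k) {f : ℕ → E} (hf : f ∈ G) :
    ∃ s, s + n₀ ≤ k ∧ (AlgebraicIndependent K fun i : Fin s => f (n₀ + i)) ∧
      ∀ j, IsAlgebraic (Algebra.adjoin K (Set.range fun i : Fin s => f (n₀ + i))) (f (n₀ + j)) := by
  classical
  let Q : ℕ → Prop := fun s => AlgebraicIndependent K fun i : Fin s => f (n₀ + i)
  have hmem : ∀ i, (fun n => f (n + i)) ∈ G := hG.shift_add_mem hf
  have hle : ∀ s, Q s → s + n₀ ≤ k := fun s h =>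
    hk s ⟨fun i n => f (n + i), fun i => hmem i, h⟩
  have hQ0 : Q 0 := algebraicIndependent_empty_type_iff.2 (algebraMap K E).injective
  have hex : ∃ s, ¬ Q (s + 1) := by
    by_contra! hcon
    have := hle _ (hcon k)
    omega
  have hQ : Q (Nat.find hex) := by
    rcases hs : Nat.find hex with _ | s
    · exact hQ0
    · have := Nat.find_min hex (m := s) (by omega)
      exact not_not.1 this
  have hnQ := Nat.find_spec hex
  set s := Nat.find hex
  refine ⟨s, hle s hQ, hQ, ?_⟩
  -- The failure of independence for `s + 1` consecutive values moves from `n₀` to every later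
  -- window; the induction below then chains the windows by transitivity.
  have step : ∀ n, n₀ ≤ n →
      IsAlgebraic (Algebra.adjoin K (Set.range fun i : Fin s => f (n + i))) (f (n + s)) := by
    intro n hn
    by_contra htr
    have hQn : AlgebraicIndependent K fun i : Fin s => f (n + i) :=
      (hG.algebraicIndependent_iff hs (z := fun (i : Fin s) m => f (m + i))
        (fun i => hmem i) hn).2 hQ
    have hopt := (AlgebraicIndependent.option_iff_transcendental hQn (f (n + s))).2 htr
    apply hnQ
    refine (hG.algebraicIndependent_iff hs (z := fun (i : Fin (s + 1)) m => f (m + i))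
      (fun i => hmem i) hn).1 ?_
    convert hopt.comp _ (finSuccEquivLast (n := s)).injective using 2 with i
    rw [Function.comp_apply]
    induction i using Fin.lastCases with
    | last => simp
    | cast i => simp
  intro j
  induction j using Nat.strong_induction_on with
  | _ j ih =>
    by_cases hj : j < s
    · exact isAlgebraic_algebraMap
        (⟨_, Algebra.subset_adjoin ⟨⟨j, hj⟩, rfl⟩⟩ :
          Algebra.adjoin K (Set.range fun i : Fin s => f (n₀ + i)))
    · have h1 := step (n₀ + (j - s)) (by omega)
      rw [show n₀ + (j - s) + s = n₀ + j by omega] at h1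
      refine IsAlgebraic.adjoin_of_forall_isAlgebraic ?_ h1
      rintro _ ⟨⟨i, rfl⟩, _⟩
      have := ih (j - s + i) (by omega)
      rwa [← add_assoc] at this

end IsShiftAlgebra

end Sequences

end Ratrec

namespace Ratrec

/-! ### Counting monomials and independence in towers. -/

section Counting

variable {σ K : Type*} [Field K]

theorem card_le_of_linearIndependent_of_totalDegree_le [Fintype σ] {ι : Type*} [Fintype ι]
    {v : ι → MvPolynomial σ K} (hv : LinearIndependent K v) {M : ℕ}
    (hd : ∀ i, (v i).totalDegree ≤ M) : Fintype.card ι ≤ (M + 1) ^ Fintype.card σ := by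
  classical
  let W := MvPolynomial.restrictDegree σ K M
  have hmem : ∀ i, v i ∈ W := fun i =>
    MvPolynomial.restrictTotalDegree_le_restrictDegree σ K M
      ((MvPolynomial.mem_restrictTotalDegree _ _ _).2 (hd i))
  let w : ι → W := fun i => ⟨v i, hmem i⟩
  have hw : LinearIndependent K w := LinearIndependent.of_comp W.subtype hv
  let S : Set (σ →₀ ℕ) := {n | ∀ i, n i ≤ M}
  let g : S → (σ → Fin (M + 1)) := fun n i => ⟨n.1 i, Nat.lt_succ_of_le (n.2 i)⟩
  have hg : Function.Injective g := by
    intro a b h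
    apply Subtype.ext
    ext i
    exact congrArg Fin.val (congrFun h i)
  have : Fintype S := Fintype.ofInjective g hg
  have hb : Module.finrank K W = Fintype.card S :=
    Module.finrank_eq_card_basis (MvPolynomial.basisRestrictSupport K S)
  calc Fintype.card ι ≤ Module.finrank K W := hw.fintype_card_le_finrank
    _ = Fintype.card S := hb
    _ ≤ Fintype.card (σ → Fin (M + 1)) := Fintype.card_le_of_injective g hg
    _ = (M + 1) ^ Fintype.card σ := by simp

/-- Divide by `(A + 1) ^ k` and let `A` tend to infinity. -/
theorem le_pow_of_forall_mul_pow_le {N e c k : ℕ}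
    (h : ∀ A : ℕ, N * (A + 1) ^ k ≤ (e * A + c) ^ k) : N ≤ e ^ k := by
  have h1 : ∀ A : ℕ, (N : ℝ) ≤ ((e * A + c : ℝ) / (A + 1)) ^ k := by
    intro A
    rw [div_pow, le_div_iff₀ (by positivity)]
    exact_mod_cast h A
  have h2 : Filter.Tendsto (fun A : ℕ => ((e * A + c : ℝ) / (A + 1)) ^ k) Filter.atTop
      (nhds ((e : ℝ) ^ k)) := by
    apply Filter.Tendsto.pow
    have h3 : Filter.Tendsto (fun A : ℕ => (e : ℝ) + (c - e : ℝ) * (1 / ((A : ℝ) + 1)))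
        Filter.atTop (nhds (e + (c - e : ℝ) * 0)) :=
      tendsto_const_nhds.add (tendsto_const_nhds.mul tendsto_one_div_add_atTop_nhds_zero_nat)
    rw [mul_zero, add_zero] at h3
    refine h3.congr fun A => ?_
    have : (A : ℝ) + 1 ≠ 0 := by positivity
    field_simp
    ring
  exact_mod_cast ge_of_tendsto' h2 h1

variable {E : Type*} [Field E] [Algebra K E]

theorem linearIndependent_prod_pow {ι R : Type*} [CommRing R] [Algebra R E] {x : ι → E}
    (hx : AlgebraicIndependent R x) :
    LinearIndependent R fun a : ι →₀ ℕ => a.prod fun i n => x i ^ n := by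
  have h := (MvPolynomial.basisMonomials ι R).linearIndependent.map'
    (MvPolynomial.aeval x).toLinearMap (LinearMap.ker_eq_bot.2 hx)
  simpa [Function.comp_def, MvPolynomial.aeval_monomial] using h

/-- The remaining `x i` stay independent over the algebraic closure of `K[x '' s]`, which contains
the `α j`; independence then multiplies along the tower. -/
theorem linearIndependent_prod_pow_mul_prod_pow {ι κ : Type*} {x : ι → E}
    (hx : AlgebraicIndependent K x)
    (s : Set ι) {α : κ → E} (hα : LinearIndependent (Algebra.adjoin K (x '' s)) α)
    (halg : ∀ j, IsAlgebraic (Algebra.adjoin K (x '' s)) (α j)) :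
    LinearIndependent K fun p : ((s →₀ ℕ) × κ) × ((sᶜ : Set ι) →₀ ℕ) =>
      (p.1.1.prod fun i n => x i ^ n) * α p.1.2 * p.2.prod fun i n => x i ^ n := by
  obtain ⟨h1, h2⟩ := (AlgebraicIndependent.iff_adjoin_image s).1 hx
  let R := Algebra.adjoin K (x '' s)
  let S := Subalgebra.algebraicClosure R E
  have h3 : AlgebraicIndependent S fun i : (sᶜ : Set ι) => x i :=
    AlgebraicIndependent.subalgebraAlgebraicClosure h2
  let α' : κ → S := fun j => ⟨α j, halg j⟩
  have hα' : LinearIndependent R α' := LinearIndependent.of_comp S.val.toLinearMap hα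
  let x' : s → R := fun i => ⟨x i, Algebra.subset_adjoin ⟨i, i.2, rfl⟩⟩
  have hcoe : (R.val.toLinearMap ∘ fun a : s →₀ ℕ => a.prod fun i n => x' i ^ n) =
      fun a : s →₀ ℕ => a.prod fun i n => x i ^ n := by
    funext a
    simp [Finsupp.prod, x']
  have hx' : LinearIndependent K fun a : s →₀ ℕ => a.prod fun i n => x' i ^ n := by
    refine LinearIndependent.of_comp R.val.toLinearMap ?_
    rw [hcoe]
    exact linearIndependent_prod_pow h1
  have h5 := linearIndependent_smul (linearIndependent_smul hx' hα')
    (linearIndependent_prod_pow h3)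
  convert h5 using 2 with p
  rw [← congrFun hcoe p.1.1, Algebra.smul_def, Algebra.smul_def]
  rfl

end Counting

/-! ### Degree bounds for fractions and the dimension bound. -/

section RatFnDegree

variable {σ K : Type*} [Field K]

/-- `f` is a fraction of two polynomials of total degree at most `d`. -/
def RatFn.DegreeLE (d : ℕ) (f : RatFn σ K) : Prop :=
  ∃ a b : MvPolynomial σ K, b ≠ 0 ∧ a.totalDegree ≤ d ∧ b.totalDegree ≤ d ∧
    f = algebraMap _ (RatFn σ K) a / algebraMap _ (RatFn σ K) b

theorem algebraMap_ratFn_ne_zero {b : MvPolynomial σ K} (hb : b ≠ 0) :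
    algebraMap _ (RatFn σ K) b ≠ 0 := by
  simpa using hb

theorem RatFn.DegreeLE.mono {d e : ℕ} {f : RatFn σ K} (hf : f.DegreeLE d) (h : d ≤ e) :
    f.DegreeLE e := by
  obtain ⟨a, b, hb, ha, hbd, hf⟩ := hf
  exact ⟨a, b, hb, ha.trans h, hbd.trans h, hf⟩

theorem RatFn.degreeLE_X (i : σ) : (RatFn.X i : RatFn σ K).DegreeLE 1 :=
  ⟨MvPolynomial.X i, 1, one_ne_zero, by simp, by simp, by simp [RatFn.X]⟩

/-- Products of powers of bounded exponent become polynomials of controlled degree after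
multiplication by a fixed polynomial. -/
theorem exists_polynomial_of_prod_pow {ι : Type*} [Fintype ι] (a b : ι → MvPolynomial σ K)
    (hb : ∀ i, b i ≠ 0) {d : ℕ} (had : ∀ i, (a i).totalDegree ≤ d)
    (hbd : ∀ i, (b i).totalDegree ≤ d) (A : ℕ) (n : ι → ℕ) (hn : ∀ i, n i ≤ A) :
    ∃ q : MvPolynomial σ K, q.totalDegree ≤ Fintype.card ι * (A * d) ∧
      algebraMap _ (RatFn σ K) q = algebraMap _ (RatFn σ K) (∏ i, b i ^ A) *
        ∏ i, (algebraMap _ (RatFn σ K) (a i) / algebraMap _ (RatFn σ K) (b i)) ^ n i := by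
  refine ⟨∏ i, a i ^ n i * b i ^ (A - n i), ?_, ?_⟩
  · refine (MvPolynomial.totalDegree_finsetProd _ _).trans ?_
    rw [← smul_eq_mul, ← Finset.card_univ, ← Finset.sum_const]
    refine Finset.sum_le_sum fun i _ => ?_
    calc (a i ^ n i * b i ^ (A - n i)).totalDegree
        ≤ (a i ^ n i).totalDegree + (b i ^ (A - n i)).totalDegree :=
          MvPolynomial.totalDegree_mul _ _
      _ ≤ n i * d + (A - n i) * d := by
          refine add_le_add ?_ ?_
          · exact (MvPolynomial.totalDegree_pow _ _).trans (Nat.mul_le_mul_left _ (had i))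
          · exact (MvPolynomial.totalDegree_pow _ _).trans (Nat.mul_le_mul_left _ (hbd i))
      _ = A * d := by rw [← add_mul, Nat.add_sub_cancel' (hn i)]
  · rw [map_prod, map_prod, ← Finset.prod_mul_distrib]
    refine Finset.prod_congr rfl fun i _ => ?_
    have h0 := algebraMap_ratFn_ne_zero (hb i)
    rw [map_mul, map_pow, map_pow, map_pow, div_pow, ← mul_div_assoc, eq_div_iff (pow_ne_zero _ h0),
      mul_assoc, ← pow_add, Nat.sub_add_cancel (hn i), mul_comm]

/-- Over the field generated by a part `x '' s` of a transcendence basis consisting of fractions of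
degree at most `d`, every family of algebraic elements which is linearly independent has at most
`(k * d) ^ k` members, where `k` is the number of variables. -/
theorem card_le_of_linearIndependent_of_isAlgebraic [Fintype σ] {ι : Type*} [Fintype ι]
    {x : ι → RatFn σ K} (hx : AlgebraicIndependent K x) (hcard : Fintype.card ι = Fintype.card σ)
    {d : ℕ} (hd : ∀ i, (x i).DegreeLE d) (s : Set ι) {N : ℕ} {α : Fin N → RatFn σ K}
    (hα : LinearIndependent (Algebra.adjoin K (x '' s)) α)
    (halg : ∀ j, IsAlgebraic (Algebra.adjoin K (x '' s)) (α j)) :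
    N ≤ (Fintype.card σ * d) ^ Fintype.card σ := by
  classical
  choose a b hb had hbd hxab using hd
  have hden : ∀ j, ∃ p q : MvPolynomial σ K, q ≠ 0 ∧
      α j = algebraMap _ (RatFn σ K) p / algebraMap _ (RatFn σ K) q := by
    intro j
    obtain ⟨p, q, hq, h⟩ := IsFractionRing.div_surjective (A := MvPolynomial σ K) (α j)
    exact ⟨p, q, nonZeroDivisors.ne_zero hq, h.symm⟩
  choose p q hq hpq using hden
  have hclear : ∀ j, ∃ r : MvPolynomial σ K,
      algebraMap _ (RatFn σ K) r = algebraMap _ (RatFn σ K) (∏ j, q j) * α j := by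
    intro j
    refine ⟨p j * ∏ i ∈ Finset.univ.erase j, q i, ?_⟩
    have h0 := algebraMap_ratFn_ne_zero (hq j)
    rw [← Finset.mul_prod_erase Finset.univ q (Finset.mem_univ j), map_mul, map_mul, hpq j]
    field_simp
  choose r hr using hclear
  let c := Finset.univ.sup fun j => (r j).totalDegree
  have hc : ∀ j, (r j).totalDegree ≤ c := fun j =>
    Finset.le_sup (f := fun j => (r j).totalDegree) (Finset.mem_univ j)
  have hcs : Fintype.card s + Fintype.card (sᶜ : Set ι) = Fintype.card σ := by
    rw [← hcard, Fintype.card_compl_set]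
    exact Nat.add_sub_cancel' (Fintype.card_subtype_le _)
  -- Monomials in `x` with exponents at most `A`, times the `α j`, become independent polynomials of
  -- degree at most `k * d * A + c` once denominators are cleared, with `k` the number of variables
  -- and `c` independent of `A`.
  refine le_pow_of_forall_mul_pow_le (c := c + 1) fun A => ?_
  let toFinsupp : ∀ t : Set ι, (t → Fin (A + 1)) → (t →₀ ℕ) := fun t f =>
    Finsupp.equivFunOnFinite.symm fun i => (f i : ℕ)
  have hinj : ∀ t, Function.Injective (toFinsupp t) := by
    intro t f g h
    funext i
    exact Fin.ext (DFunLike.congr_fun h i)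
  have hli := (linearIndependent_prod_pow_mul_prod_pow hx s hα halg).comp
    (fun P : ((s → Fin (A + 1)) × Fin N) × ((sᶜ : Set ι) → Fin (A + 1)) =>
      ((toFinsupp s P.1.1, P.1.2), toFinsupp sᶜ P.2)) (by
        rintro ⟨⟨f, j⟩, g⟩ ⟨⟨f', j'⟩, g'⟩ h
        simp only [Prod.mk.injEq] at h ⊢
        exact ⟨⟨hinj _ h.1.1, h.1.2⟩, hinj _ h.2⟩)
  let C : MvPolynomial σ K :=
    (∏ i : s, b i ^ A) * (∏ j, q j) * ∏ i : (sᶜ : Set ι), b i ^ A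
  have hC : C ≠ 0 := by
    refine mul_ne_zero (mul_ne_zero ?_ ?_) ?_
    · exact Finset.prod_ne_zero_iff.2 fun i _ => pow_ne_zero _ (hb i)
    · exact Finset.prod_ne_zero_iff.2 fun j _ => hq j
    · exact Finset.prod_ne_zero_iff.2 fun i _ => pow_ne_zero _ (hb i)
  have hpoly : ∀ P : ((s → Fin (A + 1)) × Fin N) × ((sᶜ : Set ι) → Fin (A + 1)),
      ∃ w : MvPolynomial σ K, w.totalDegree ≤ Fintype.card σ * d * A + c ∧
        algebraMap _ (RatFn σ K) w = algebraMap _ (RatFn σ K) C *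
          (((toFinsupp s P.1.1).prod fun i n => x i ^ n) * α P.1.2 *
            (toFinsupp sᶜ P.2).prod fun i n => x i ^ n) := by
    rintro ⟨⟨f, j⟩, g⟩
    obtain ⟨q₁, hq₁, h₁⟩ := exists_polynomial_of_prod_pow (fun i : s => a i) (fun i => b i)
      (fun i => hb i) (fun i => had i) (fun i => hbd i) A (fun i => (f i : ℕ))
      (fun i => Nat.le_of_lt_succ (f i).2)
    obtain ⟨q₂, hq₂, h₂⟩ := exists_polynomial_of_prod_pow (fun i : (sᶜ : Set ι) => a i)
      (fun i => b i) (fun i => hb i) (fun i => had i) (fun i => hbd i) A (fun i => (g i : ℕ))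
      (fun i => Nat.le_of_lt_succ (g i).2)
    refine ⟨q₁ * r j * q₂, ?_, ?_⟩
    · calc (q₁ * r j * q₂).totalDegree
          ≤ q₁.totalDegree + (r j).totalDegree + q₂.totalDegree :=
            (MvPolynomial.totalDegree_mul _ _).trans
              (Nat.add_le_add_right (MvPolynomial.totalDegree_mul _ _) _)
        _ ≤ Fintype.card s * (A * d) + c + Fintype.card (sᶜ : Set ι) * (A * d) :=
            add_le_add (add_le_add hq₁ (hc j)) hq₂
        _ = Fintype.card σ * d * A + c := by rw [← hcs]; ring
    · rw [map_mul, map_mul, h₁, h₂, hr]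
      simp only [C, map_mul]
      rw [Finsupp.prod_fintype _ _ (by simp), Finsupp.prod_fintype _ _ (by simp)]
      simp only [hxab, toFinsupp, Finsupp.equivFunOnFinite_symm_apply_apply]
      ring
  choose w hwd hw using hpoly
  have hwli : LinearIndependent K w := by
    refine LinearIndependent.of_comp
      (IsScalarTower.toAlgHom K (MvPolynomial σ K) (RatFn σ K)).toLinearMap ?_
    have := hli.map' (LinearMap.mulLeft K (algebraMap _ (RatFn σ K) C))
      (LinearMap.ker_eq_bot.2 (mul_right_injective₀ (algebraMap_ratFn_ne_zero hC)))
    rw [show (IsScalarTower.toAlgHom K (MvPolynomial σ K) (RatFn σ K)).toLinearMap ∘ w = _ from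
      funext hw]
    exact this
  have hcount := card_le_of_linearIndependent_of_totalDegree_le hwli hwd
  rw [Fintype.card_prod, Fintype.card_prod, Fintype.card_fun, Fintype.card_fun, Fintype.card_fin,
    Fintype.card_fin] at hcount
  calc N * (A + 1) ^ Fintype.card σ
      = (A + 1) ^ Fintype.card s * N * (A + 1) ^ Fintype.card (sᶜ : Set ι) := by
        rw [← hcs, pow_add]; ring
    _ ≤ _ := hcount

end RatFnDegree

end Ratrec

namespace Ratrec

/-! ### Dimension growth in chains of fields. -/

section Chain

variable {K E : Type*} [Field K] [Field E] [Algebra K E]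

/-- Adjoining an element outside the intermediate field `L` to a family in `L` which is linearly
independent over a subfield doubles the family. -/
theorem linearIndependent_mul_pow_of_notMem {F L : IntermediateField K E} (hFL : F ≤ L)
    {ι : Type*} {α : ι → E} (hα : LinearIndependent F α) (hL : ∀ i, α i ∈ L) {g : E} (hg : g ∉ L) :
    LinearIndependent F fun p : ι × Fin 2 => α p.1 * g ^ (p.2 : ℕ) := by
  let _ : Algebra F L := (IntermediateField.inclusion hFL).toAlgebra
  have : IsScalarTower F L E := IsScalarTower.of_algebraMap_eq fun _ => rfl
  let α' : ι → L := fun i => ⟨α i, hL i⟩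
  have hα' : LinearIndependent F α' :=
    LinearIndependent.of_comp (IsScalarTower.toAlgHom F L E).toLinearMap hα
  have h2 : LinearIndependent L fun i : Fin 2 => g ^ (i : ℕ) := by
    have : (fun i : Fin 2 => g ^ (i : ℕ)) = ![1, g] := by
      funext i
      fin_cases i <;> simp
    rw [this, LinearIndependent.pair_iff' one_ne_zero]
    intro a ha
    apply hg
    rw [← ha, Algebra.smul_def, mul_one]
    exact a.2
  have h := linearIndependent_smul hα' h2
  have heq : (fun p : ι × Fin 2 => α p.1 * g ^ (p.2 : ℕ)) =
      fun p : ι × Fin 2 => α' p.1 • g ^ (p.2 : ℕ) :=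
    funext fun p => (Algebra.smul_def (α' p.1) (g ^ (p.2 : ℕ))).symm
  rw [heq]
  exact h

theorem exists_linearIndependent_of_notMem (g : ℕ → E) (s j : ℕ)
    (hj : ∀ i < j, g (s + i) ∉ IntermediateField.adjoin K (Set.range fun l : Fin (s + i) => g l)) :
    ∃ α : Fin (2 ^ j) → E,
      LinearIndependent (IntermediateField.adjoin K (Set.range fun l : Fin s => g l)) α ∧
        ∀ i, α i ∈ IntermediateField.adjoin K (Set.range fun l : Fin (s + j) => g l) := by
  induction j with
  | zero =>
    refine ⟨fun _ => 1, ?_, fun i => one_mem _⟩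
    have : Subsingleton (Fin (2 ^ 0)) := by simpa using (inferInstance : Subsingleton (Fin 1))
    exact LinearIndependent.of_subsingleton 0 one_ne_zero
  | succ j ih =>
    obtain ⟨α, hα, hmem⟩ := ih fun i hi => hj i (by omega)
    have hmono : ∀ a b : ℕ, a ≤ b →
        IntermediateField.adjoin K (Set.range fun l : Fin a => g l) ≤
          IntermediateField.adjoin K (Set.range fun l : Fin b => g l) := by
      intro a b hab
      apply IntermediateField.adjoin.mono
      rintro _ ⟨l, rfl⟩
      exact ⟨Fin.castLE hab l, rfl⟩
    have h := linearIndependent_mul_pow_of_notMem (hmono s (s + j) (by omega)) hα hmem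
      (hj j (by omega))
    let e : Fin (2 ^ (j + 1)) ≃ Fin (2 ^ j) × Fin 2 :=
      (finCongr (pow_succ 2 j)).trans finProdFinEquiv.symm
    refine ⟨_, h.comp e e.injective, fun i => ?_⟩
    refine mul_mem (hmono _ _ (by omega) (hmem _)) (pow_mem ?_ _)
    exact IntermediateField.subset_adjoin _ _ ⟨⟨s + j, by omega⟩, rfl⟩

theorem isAlgebraic_of_mem_adjoin {S T : Set E}
    (h : ∀ x ∈ S, IsAlgebraic (Algebra.adjoin K T) x) {y : E}
    (hy : y ∈ IntermediateField.adjoin K S) : IsAlgebraic (Algebra.adjoin K T) y := by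
  obtain ⟨a, ha, b, hb, rfl⟩ := IntermediateField.mem_adjoin_iff_div.1 hy
  have key : ∀ z ∈ Algebra.adjoin K S, IsAlgebraic (Algebra.adjoin K T) z := fun z hz =>
    IsAlgebraic.adjoin_of_forall_isAlgebraic (fun x hx => h x hx.1)
      (isAlgebraic_algebraMap (⟨z, hz⟩ : Algebra.adjoin K S))
  rw [div_eq_mul_inv]
  exact (key a ha).mul (key b hb).inv

end Chain

/-! ### Transcendence bases of the rational function field. -/

section Transcendence

variable {σ K : Type*} [Field K]

theorem algebraicIndependent_ratFn_X : AlgebraicIndependent K (RatFn.X : σ → RatFn σ K) :=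
  (MvPolynomial.algebraicIndependent_X σ K).map'
    (f := IsScalarTower.toAlgHom K (MvPolynomial σ K) (RatFn σ K))
    (IsFractionRing.injective (MvPolynomial σ K) (RatFn σ K))

theorem isAlgebraic_adjoin_of_range_X_subset {S : Set (RatFn σ K)} (hS : Set.range RatFn.X ⊆ S) :
    Algebra.IsAlgebraic (Algebra.adjoin K S) (RatFn σ K) := by
  have key : ∀ p : MvPolynomial σ K,
      IsAlgebraic (Algebra.adjoin K S) (algebraMap _ (RatFn σ K) p) := by
    intro p
    have hp : algebraMap _ (RatFn σ K) p ∈ Algebra.adjoin K S := by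
      refine Algebra.adjoin_mono hS ?_
      rw [Algebra.adjoin_range_eq_range_aeval]
      refine ⟨p, ?_⟩
      have := MvPolynomial.comp_aeval_apply
        (IsScalarTower.toAlgHom K (MvPolynomial σ K) (RatFn σ K)) (f := MvPolynomial.X) p
      rw [MvPolynomial.aeval_X_left_apply] at this
      exact this.symm
    exact isAlgebraic_algebraMap (⟨_, hp⟩ : Algebra.adjoin K S)
  refine ⟨fun f => ?_⟩
  obtain ⟨a, b, _, rfl⟩ := IsFractionRing.div_surjective (A := MvPolynomial σ K) f
  rw [div_eq_mul_inv]
  exact (key a).mul (key b).inv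

theorem isTranscendenceBasis_ratFn_X : IsTranscendenceBasis K (RatFn.X : σ → RatFn σ K) :=
  algebraicIndependent_ratFn_X.isTranscendenceBasis_iff_isAlgebraic.2
    (isAlgebraic_adjoin_of_range_X_subset subset_rfl)

theorem card_le_of_algebraicIndependent_ratFn [Fintype σ] {r : ℕ} {x : Fin r → RatFn σ K}
    (hx : AlgebraicIndependent K x) : r ≤ Fintype.card σ := by
  have h1 := hx.lift_cardinalMk_le_trdeg
  have h2 := (isTranscendenceBasis_ratFn_X (σ := σ) (K := K)).lift_cardinalMk_eq_trdeg
  have h3 : Cardinal.lift.{u_1} (Cardinal.lift.{max u_1 u_2} (Cardinal.mk (Fin r))) ≤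
    Cardinal.lift.{max u_1 u_2} (Cardinal.mk σ) := by
    rw [h2]
    simpa using h1
  simpa using h3

/-- Complete `h` to a transcendence basis by variables; these have degree `1 ≤ d`, so the general
bound applies. -/
theorem card_le_of_linearIndependent_adjoin_range [Fintype σ] {s : ℕ} {h : Fin s → RatFn σ K}
    (hh : AlgebraicIndependent K h) {d : ℕ} (hd1 : 1 ≤ d) (hd : ∀ i, (h i).DegreeLE d) {N : ℕ}
    {α : Fin N → RatFn σ K} (hα : LinearIndependent (Algebra.adjoin K (Set.range h)) α)
    (halg : ∀ j, IsAlgebraic (Algebra.adjoin K (Set.range h)) (α j)) :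
    N ≤ (Fintype.card σ * d) ^ Fintype.card σ := by
  classical
  have hspan := isAlgebraic_adjoin_of_range_X_subset (σ := σ) (K := K)
    (S := Set.range h ∪ Set.range RatFn.X) Set.subset_union_right
  obtain ⟨u, hu1, hu2, hu⟩ := exists_isTranscendenceBasis_between (Set.range h)
    (Set.range h ∪ Set.range RatFn.X) Set.subset_union_left hh.coe_range
  have hcard := hu.lift_cardinalMk_eq (isTranscendenceBasis_ratFn_X (σ := σ) (K := K))
  rw [Cardinal.lift_mk_eq'] at hcard
  obtain ⟨e⟩ := hcard
  have : Fintype u := Fintype.ofEquiv σ e.symm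
  have himage : ((↑) : u → RatFn σ K) '' {i | (i : RatFn σ K) ∈ Set.range h} = Set.range h := by
    ext y
    constructor
    · rintro ⟨i, hi, rfl⟩
      exact hi
    · exact fun hy => ⟨⟨y, hu1 hy⟩, hy, rfl⟩
  refine card_le_of_linearIndependent_of_isAlgebraic hu.1 (Fintype.card_congr e) (fun i => ?_)
    {i | (i : RatFn σ K) ∈ Set.range h} (by rwa [himage]) (by rwa [himage])
  rcases hu2 i.2 with ⟨j, hj⟩ | ⟨j, hj⟩
  · exact hj ▸ hd j
  · exact hj ▸ (RatFn.degreeLE_X j).mono hd1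

end Transcendence

/-! ### Substitution into rational functions. -/

section Substitution

variable {σ τ K : Type*} [Field K]

theorem exists_polynomial_of_aeval [Fintype τ] (a b : τ → MvPolynomial σ K)
    (hb : ∀ i, b i ≠ 0) {d D : ℕ} (had : ∀ i, (a i).totalDegree ≤ d)
    (hbd : ∀ i, (b i).totalDegree ≤ d) (p : MvPolynomial τ K) (hp : p.totalDegree ≤ D) :
    ∃ q : MvPolynomial σ K, q.totalDegree ≤ Fintype.card τ * (D * d) ∧
      algebraMap _ (RatFn σ K) q = algebraMap _ (RatFn σ K) (∏ i, b i ^ D) *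
        MvPolynomial.aeval
          (fun i => algebraMap _ (RatFn σ K) (a i) / algebraMap _ (RatFn σ K) (b i)) p := by
  have h : ∀ m : p.support, ∃ q : MvPolynomial σ K, q.totalDegree ≤ Fintype.card τ * (D * d) ∧
      algebraMap _ (RatFn σ K) q = algebraMap _ (RatFn σ K) (∏ i, b i ^ D) *
        ∏ i, (algebraMap _ (RatFn σ K) (a i) / algebraMap _ (RatFn σ K) (b i)) ^ m.1 i :=
    fun m => exists_polynomial_of_prod_pow a b hb had hbd D m.1 fun i =>
      ((MvPolynomial.degreeOf_le_iff.1 (MvPolynomial.degreeOf_le_totalDegree p i)) m.1 m.2).trans hp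
  choose q hq hqe using h
  refine ⟨∑ m : p.support, MvPolynomial.C (p.coeff m.1) * q m, ?_, ?_⟩
  · refine MvPolynomial.totalDegree_finsetSum_le fun m _ => ?_
    refine (MvPolynomial.totalDegree_mul _ _).trans ?_
    rw [MvPolynomial.totalDegree_C, zero_add]
    exact hq m
  · rw [MvPolynomial.aeval_def, MvPolynomial.eval₂_eq', Finset.mul_sum, map_sum,
      ← Finset.sum_coe_sort p.support]
    refine Finset.sum_congr rfl fun m _ => ?_
    rw [map_mul, hqe, ← MvPolynomial.algebraMap_eq, ← IsScalarTower.algebraMap_apply]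
    ring

/-- Numerator and denominator of `P` are cleared by the same factor `∏ i, b i ^ D`, which cancels in
the quotient. -/
theorem RatFn.DegreeLE.eval [Fintype τ] {y : τ → RatFn σ K} {d D : ℕ}
    (hy : ∀ i, (y i).DegreeLE d) {P : RatFn τ K} (hP : P.degree ≤ D) (hdef : P.DefinedAt y) :
    (P.eval y).DegreeLE (Fintype.card τ * (D * d)) := by
  choose a b hb had hbd hab using hy
  obtain ⟨q₁, hq₁, h₁⟩ := exists_polynomial_of_aeval a b hb had hbd P.num
    ((le_max_left _ _).trans hP)
  obtain ⟨q₂, hq₂, h₂⟩ := exists_polynomial_of_aeval a b hb had hbd P.den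
    ((le_max_right _ _).trans hP)
  have hy : y = fun i => algebraMap _ (RatFn σ K) (a i) / algebraMap _ (RatFn σ K) (b i) :=
    funext hab
  rw [← hy] at h₁ h₂
  have hC : algebraMap _ (RatFn σ K) (∏ i, b i ^ D) ≠ 0 :=
    algebraMap_ratFn_ne_zero (Finset.prod_ne_zero_iff.2 fun i _ => pow_ne_zero _ (hb i))
  refine ⟨q₁, q₂, ?_, hq₁, hq₂, ?_⟩
  · rintro rfl
    rw [map_zero] at h₂
    exact mul_ne_zero hC hdef h₂.symm
  · rw [h₁, h₂, mul_div_mul_left _ _ hC]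
    rfl

/-- The reduced denominator divides `b`, so any representation with nonvanishing denominator may
replace lowest terms. -/
theorem RatFn.definedAt_and_eval_of_div {E : Type*} [Field E] [Algebra K E]
    (a b : MvPolynomial σ K) (y : σ → E) (hb : MvPolynomial.aeval y b ≠ 0) :
    (algebraMap _ (RatFn σ K) a / algebraMap _ (RatFn σ K) b).DefinedAt y ∧
      (algebraMap _ (RatFn σ K) a / algebraMap _ (RatFn σ K) b).eval y =
        MvPolynomial.aeval y a / MvPolynomial.aeval y b := by
  set f : RatFn σ K := algebraMap _ (RatFn σ K) a / algebraMap _ (RatFn σ K) b with hf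
  have hb0 : b ≠ 0 := by
    rintro rfl
    exact hb (map_zero _)
  have hden : f.den ≠ 0 := nonZeroDivisors.ne_zero (IsFractionRing.den (MvPolynomial σ K) f).2
  have hfrac : algebraMap _ (RatFn σ K) f.num / algebraMap _ (RatFn σ K) f.den = f :=
    IsFractionRing.mk'_num_den' (MvPolynomial σ K) f
  have hmul : f.num * b = a * f.den := by
    have h := hfrac.trans hf
    rw [div_eq_div_iff (algebraMap_ratFn_ne_zero hden) (algebraMap_ratFn_ne_zero hb0),
      ← map_mul, ← map_mul] at h
    exact IsFractionRing.injective (MvPolynomial σ K) (RatFn σ K) h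
  have hrel : IsRelPrime f.num f.den := IsFractionRing.num_den_reduced (MvPolynomial σ K) f
  have hdvd : f.den ∣ b :=
    hrel.symm.dvd_of_dvd_mul_left ⟨a, hmul.trans (mul_comm _ _)⟩
  have hdef : MvPolynomial.aeval y f.den ≠ 0 := by
    obtain ⟨c, hc⟩ := hdvd
    intro h0
    apply hb
    rw [hc, map_mul, h0, zero_mul]
  refine ⟨hdef, ?_⟩
  unfold RatFn.eval
  rw [div_eq_div_iff hdef hb, ← map_mul, ← map_mul, hmul]

end Substitution

end Ratrec

namespace Ratrec

/-! ### Rational systems and the simple recursion. -/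

section System

variable {K : Type*} [Field K] {k D : ℕ} {P : Fin k → RatFn (Fin k) K}

theorem IsSystem.shift_mem {E : Type*} [Field E] [Algebra K E] {u : Fin k → ℕ → E}
    (hu : IsSystem D P u) (i : Fin k) : (fun n => u i (n + 1)) ∈ rationalAlong K u :=
  ⟨(P i).num, (P i).den, fun n => ⟨hu.defined n i, hu.step n i⟩⟩

variable {F : Fin k → ℕ → RatFn (Fin k) K}

theorem IsSystem.isShiftAlgebra (hF : IsSystem D P F) (hinit : ∀ i, F i 0 = RatFn.X i) :
    IsShiftAlgebra (rationalAlong K F) where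
  shift_mem _ hz := shift_mem_rationalAlong hF.shift_mem hz
  eq_zero z hz h0 := by
    refine eq_zero_of_mem_rationalAlong (n₀ := 0) ?_ hz h0 1
    simp only [hinit]
    exact algebraicIndependent_ratFn_X

theorem IsSystem.degreeLE (hF : IsSystem D P F) (hinit : ∀ i, F i 0 = RatFn.X i) (n : ℕ)
    (i : Fin k) : (F i n).DegreeLE ((k * D) ^ n) := by
  induction n generalizing i with
  | zero =>
    rw [hinit]
    exact RatFn.degreeLE_X i
  | succ n ih =>
    rw [hF.step]
    convert RatFn.DegreeLE.eval ih (hF.degree_le i) (hF.defined n i) using 1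
    rw [Fintype.card_fin]
    ring

theorem le_cube_mul_log (hk : 0 < k) (hD : 0 < D) {j : ℕ}
    (h : 2 ^ j ≤ (k * (k * D) ^ (k - 1)) ^ k) :
    (j : ℝ) ≤ (k : ℝ) ^ 3 * Real.log ((k : ℝ) * (D : ℝ)) := by
  have hlog : 0 ≤ Real.log ((k : ℝ) * (D : ℝ)) := by
    apply Real.log_nonneg
    exact_mod_cast Nat.mul_pos hk hD
  -- For `k = 1` the hypothesis forces `j = 0`. For `k ≥ 2`, the factor `1 / log 2 ≤ 2` is absorbed
  -- by `k`.
  rcases Nat.lt_or_ge k 2 with hk2 | hk2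
  · obtain rfl : k = 1 := by omega
    have hj : j = 0 := by
      by_contra hj
      have := Nat.one_lt_two_pow hj
      simp at h
      omega
    rw [hj, Nat.cast_zero]
    positivity
  · have h1 : 2 ^ j ≤ (k * D) ^ (k * k) := by
      calc 2 ^ j ≤ (k * (k * D) ^ (k - 1)) ^ k := h
        _ ≤ ((k * D) * (k * D) ^ (k - 1)) ^ k := by
          gcongr
          exact Nat.le_mul_of_pos_right k hD
        _ = (k * D) ^ (k * k) := by
          rw [← pow_succ', Nat.sub_add_cancel hk, ← pow_mul]
    have h2 : (j : ℝ) * Real.log 2 ≤ ((k * k : ℕ) : ℝ) * Real.log ((k : ℝ) * (D : ℝ)) := by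
      rw [← Real.log_pow, ← Real.log_pow]
      apply Real.log_le_log (by positivity)
      exact_mod_cast h1
    have h3 : (2 : ℝ) ≤ k := by exact_mod_cast hk2
    have h4 : (1 / 2 : ℝ) ≤ Real.log 2 := by linarith [Real.log_two_gt_d9]
    have h5 : (j : ℝ) * (1 / 2) ≤ (j : ℝ) * Real.log 2 :=
      mul_le_mul_of_nonneg_left h4 (Nat.cast_nonneg j)
    have h6 : 2 * ((k : ℝ) ^ 2 * Real.log ((k : ℝ) * (D : ℝ))) ≤
        k * ((k : ℝ) ^ 2 * Real.log ((k : ℝ) * (D : ℝ))) :=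
      mul_le_mul_of_nonneg_right h3 (by positivity)
    push_cast at h2
    linarith

/-- A sequence in a shift algebra which is, at a stable index `n₀`, a rational function of its first
`M` values from `n₀` on, satisfies a simple recursion of order `n₀ + M`. -/
theorem IsShiftAlgebra.exists_satisfiesSimpleRecursion {E : Type*} [Field E] [Algebra K E]
    {G : Subalgebra K (ℕ → E)} (hG : IsShiftAlgebra G) {n₀ : ℕ} (hs : StableFrom G n₀)
    {f : ℕ → E} (hf : f ∈ G) {M : ℕ}
    (hM : f (n₀ + M) ∈ IntermediateField.adjoin K (Set.range fun l : Fin M => f (n₀ + l))) :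
    ∃ R : RatFn (Fin (n₀ + M + 1)) K, SatisfiesSimpleRecursion R f := by
  obtain ⟨a, b, hb, hab⟩ : ∃ a b : MvPolynomial (Fin M) K,
      MvPolynomial.aeval (fun l : Fin M => f (n₀ + l)) b ≠ 0 ∧
        f (n₀ + M) * MvPolynomial.aeval (fun l : Fin M => f (n₀ + l)) b =
          MvPolynomial.aeval (fun l : Fin M => f (n₀ + l)) a := by
    obtain ⟨a, b, h⟩ := (IntermediateField.mem_adjoin_range_iff _ _ _).1 hM
    by_cases hb : MvPolynomial.aeval (fun l : Fin M => f (n₀ + l)) b = 0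
    -- Division by zero gives `0`, so here `f (n₀ + M) = 0`.
    · refine ⟨0, 1, by simp, ?_⟩
      rw [h, hb]
      simp
    · exact ⟨a, b, hb, by rw [h, div_mul_cancel₀ _ hb]⟩
  have hmem : ∀ i, (fun n => f (n + i)) ∈ G := hG.shift_add_mem hf
  have hb' : ∀ n, n₀ ≤ n → MvPolynomial.aeval (fun l : Fin M => f (n + l)) b ≠ 0 := fun n hn h =>
    hb ((hG.apply_eq_zero_iff hs
      (aeval_seq_mem (z := fun (l : Fin M) n => f (n + l)) (fun l => hmem l) b) hn).1 h)
  have hab' : ∀ n, n₀ ≤ n → f (n + M) * MvPolynomial.aeval (fun l : Fin M => f (n + l)) b =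
      MvPolynomial.aeval (fun l : Fin M => f (n + l)) a := fun n hn =>
    sub_eq_zero.1 ((hG.apply_eq_zero_iff hs (sub_mem (mul_mem (hmem M)
      (aeval_seq_mem (z := fun (l : Fin M) n => f (n + l)) (fun l => hmem l) b))
      (aeval_seq_mem (z := fun (l : Fin M) n => f (n + l)) (fun l => hmem l) a)) hn).2
        (sub_eq_zero.2 hab))
  -- The relation is used at index `n + n₀ + 1`, which exceeds `n₀` for every `n`; the first `n₀ +
  -- 1` variables do not occur.
  let ρ : Fin M → Fin (n₀ + M + 1) := fun l => ⟨n₀ + 1 + l, by omega⟩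
  refine ⟨algebraMap _ (RatFn (Fin (n₀ + M + 1)) K) (MvPolynomial.rename ρ a) /
    algebraMap _ (RatFn (Fin (n₀ + M + 1)) K) (MvPolynomial.rename ρ b), fun n => ?_⟩
  have hval : ∀ p : MvPolynomial (Fin M) K,
      MvPolynomial.aeval (fun j : Fin (n₀ + M + 1) => f (n + j)) (MvPolynomial.rename ρ p) =
        MvPolynomial.aeval (fun l : Fin M => f (n + (n₀ + 1) + l)) p := by
    intro p
    rw [MvPolynomial.aeval_rename]
    congr 2
    funext l
    simp only [Function.comp_apply, ρ]
    congr 1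
    omega
  have h0 := hb' (n + (n₀ + 1)) (by omega)
  obtain ⟨h1, h2⟩ := RatFn.definedAt_and_eval_of_div (MvPolynomial.rename ρ a)
    (MvPolynomial.rename ρ b) (fun j : Fin (n₀ + M + 1) => f (n + j)) (by rwa [hval])
  refine ⟨h1, ?_⟩
  rw [h2, hval, hval, eq_div_iff h0, ← hab' _ (by omega)]
  congr 2
  omega

open scoped IntermediateField.algebraAdjoinAdjoin in
theorem IsSystem.exists_satisfiesSimpleRecursion (hk : 0 < k) (hD : 0 < D) (hF : IsSystem D P F)
    (hinit : ∀ i, F i 0 = RatFn.X i) (i₀ : Fin k) :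
    ∃ (m : ℕ) (R : RatFn (Fin (m + 1)) K), SatisfiesSimpleRecursion R (F i₀) ∧
      (m : ℝ) ≤ (k : ℝ) + (k : ℝ) ^ 3 * Real.log ((k : ℝ) * (D : ℝ)) := by
  classical
  have hG := hF.isShiftAlgebra hinit
  obtain ⟨n₀, hs, hn₀⟩ := hG.exists_stableFrom (k := k) fun r ⟨z, _, hz⟩ => by
    simpa using card_le_of_algebraicIndependent_ratFn hz
  have hf : F i₀ ∈ rationalAlong K F := coord_mem_rationalAlong i₀
  obtain ⟨s, hsk, hind, halg⟩ := hG.exists_algebraicIndependent_initial hs hn₀ hf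
  let g : ℕ → RatFn (Fin k) K := fun j => F i₀ (n₀ + j)
  let B := (k * (k * D) ^ (k - 1)) ^ k
  have hbound : ∀ j, (∀ i < j, g (s + i) ∉
      IntermediateField.adjoin K (Set.range fun l : Fin (s + i) => g l)) → 2 ^ j ≤ B := by
    intro j hj
    obtain ⟨α, hα, hmem⟩ := exists_linearIndependent_of_notMem g s j hj
    have h := card_le_of_linearIndependent_adjoin_range (d := (k * D) ^ (k - 1)) hind
      (Nat.one_le_pow _ _ (Nat.mul_pos hk hD))
      -- The exponent `k - 1` suffices because `i < s` and `s + n₀ ≤ k` give `n₀ + i ≤ k - 1`.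
      (fun i => (hF.degreeLE hinit _ i₀).mono
        (Nat.pow_le_pow_right (Nat.mul_pos hk hD) (by omega)))
      (α := α) (hα.restrict_scalars' _)
      (fun i => isAlgebraic_of_mem_adjoin (by rintro _ ⟨l, rfl⟩; exact halg l) (hmem i))
    simpa using h
  have hex : ∃ j, g (s + j) ∈
      IntermediateField.adjoin K (Set.range fun l : Fin (s + j) => g l) := by
    by_contra! hcon
    exact absurd (hbound B fun i _ => hcon i) (not_le.2 Nat.lt_two_pow_self)
  have hj := hbound (Nat.find hex) fun i hi => Nat.find_min hex hi
  obtain ⟨R, hR⟩ := hG.exists_satisfiesSimpleRecursion hs hf (Nat.find_spec hex)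
  refine ⟨_, R, hR, ?_⟩
  have h1 := le_cube_mul_log hk hD hj
  have h2 : ((s + n₀ : ℕ) : ℝ) ≤ k := by exact_mod_cast hsk
  push_cast at h2 ⊢
  linarith

end System

end Ratrec

theorem theorem4p1 (k D : ℕ) (hk : 0 < k) (hD : 0 < D)
    (P : Fin k → Ratrec.RatFn (Fin k) ℚ) (F : Fin k → ℕ → Ratrec.RatFn (Fin k) ℚ)
    (hF : Ratrec.IsSystem D P F) (hinit : ∀ i, F i 0 = Ratrec.RatFn.X i) :
    ∃ (m : ℕ) (R : Ratrec.RatFn (Fin (m + 1)) ℚ),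
      Ratrec.SatisfiesSimpleRecursion R (F ⟨0, hk⟩) ∧
        (m : ℝ) ≤ (k : ℝ) + (k : ℝ) ^ 3 * Real.log ((k : ℝ) * (D : ℝ)) := by
  -- The statement uses the `ℚ`-algebra structure of a characteristic-zero division ring, the
  -- general result that of the localization; they coincide.
  have halg : (DivisionRing.toRatAlgebra : Algebra ℚ (Ratrec.RatFn (Fin k) ℚ)) =
      OreLocalization.instAlgebra := Subsingleton.elim _ _
  rw [halg] at hF ⊢
  exact hF.exists_satisfiesSimpleRecursion hk hD hinit ⟨0, hk⟩
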